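/- Let $\Omega$ be a complete separable metric space and let $\nu(d\beta\,d\omega)$ be a Lévy measure on $\mathbb{R}\times\Omega$, i.e. a $\sigma$-finite Borel measure with $\nu(\{0\}\times\Omega)=0$ and $\iint_{\mathbb{R}\times K}(1\wedge\beta^2)\,\nu(d\beta\,d\omega)<\infty$ for each compact $K\subset\Omega$. Suppose that $\nu$ satisfies the local $L_1$ integrability condition $$\iint_{\mathbb{R}\times K}(1\wedge|\beta|)\,\nu(d\beta\,d\omega)<\infty\quad\text{for each compact }K\subset\Omega .$$ Let $\mathcal N$ be a Poisson random measure on $\mathbb{R}\times\Omega$ with intensity measure $\nu$, i.e. a random measure that assigns independent random variables $\mathcal N(C_i)\sim\mathrm{Po}(\nu(C_i))$ to disjoint Borel sets $C_i\subset\mathbb{R}\times\Omega$ (with $\mathcal N(C_i)=\infty$ almost surely if $\nu(C_i)=\infty$). Then for every Borel measurable $\phi:\Omega\to\mathbb{R}$ with $$\iint_{\mathbb{R}\times\Omega}\bigl(1\wedge|\beta\phi(\omega)|\bigr)\,\nu(d\beta\,d\omega)<\infty ,$$ the uncompensated integral $$\mathcal L[\phi]=\iint_{\mathbb{R}\times\Omega}\beta\,\phi(\omega)\,\mathcal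 N(d\beta\,d\omega)=\sum_{0\le j<J}\phi(\omega_j)\beta_j$$ is well defined. That is, almost surely $\mathcal N$ is a sum of $J=\mathcal N(\mathbb{R}\times\Omega)\le\infty$ unit point masses at points $(\beta_j,\omega_j)$, $0\le j<J$ (listed with multiplicity), the integral converges absolutely, and the sum converges to it unconditionally for every such listing of the points; moreover $\mathcal L[\phi]$ is a random variable. For every $t\in\mathbb{R}$ its characteristic function is $$\mathbb{E}\bigl[e^{it\mathcal L[\phi]}\bigr]=\exp\Bigl\{\iint_{\mathbb{R}\times\Omega}\bigl(e^{it\phi(\omega)\beta}-1-it\phi(\omega)h(\beta)\bigr)\,\nu(d\beta\,d\omega)\Bigr\}\quad\text{with compensator }h\equiv0,$$ i.e. $\mathbb{E}[e^{it\mathcal L[\phi]}]=\exp\{\iint_{\mathbb{R}\times\Omega}(e^{it\phi(\omega)\beta}-1)\,\nu(d\beta\,d\omega)\}$, and the integral in the exponent converges absolutely. -/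

import Mathlib

open MeasureTheory ProbabilityTheory
open scoped ENNReal

namespace LevyField

noncomputable section

/-- The Poisson law with mean `m ∈ [0, ∞]`, as a law on `[0, ∞]`;
the Poisson law with infinite mean is the point mass at `∞`. -/
def poissonLaw (m : ℝ≥0∞) : Measure ℝ≥0∞ :=
  if m = ∞ then Measure.dirac ∞ else (poissonMeasure m.toNNReal).map (fun n : ℕ => (n : ℝ≥0∞))

/-- `N` is a Poisson random measure on `E` with intensity measure `ν`, over the probability
space `(S, P)`: a random measure that assigns independent random variables
`N(Cᵢ) ∼ Po(ν(Cᵢ))` to disjoint measurable sets `Cᵢ`. -/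
structure IsPoissonRandomMeasure {S E : Type*} [MeasurableSpace S] [MeasurableSpace E]
    (N : S → Measure E) (ν : Measure E) (P : Measure S) : Prop where
  measurable : Measurable N
  map_eq : ∀ C : Set E, MeasurableSet C → P.map (fun s => N s C) = poissonLaw (ν C)
  indep : ∀ (n : ℕ) (C : Fin n → Set E), (∀ i, MeasurableSet (C i)) →
    (∀ i j, i ≠ j → Disjoint (C i) (C j)) → iIndepFun (fun i s => N s (C i)) P

/-- Lévy measures on `ℝ × Ω`: σ-finite measures without mass on `{0} × Ω` such that
`∬_{ℝ × K} (1 ∧ β²) ν(dβ dω) < ∞` for each compact `K ⊆ Ω`. -/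
structure IsLevyMeasure {Ω : Type*} [TopologicalSpace Ω] [MeasurableSpace Ω]
    (ν : Measure (ℝ × Ω)) : Prop where
  sigmaFinite : SigmaFinite ν
  zero_mass : ν ({0} ×ˢ Set.univ) = 0
  local_L2 : ∀ K : Set Ω, IsCompact K →
    ∫⁻ z in Set.univ ×ˢ K, min 1 (ENNReal.ofReal (z.1 ^ 2)) ∂ν < ∞

/-- Local `L₁` integrability: `∬_{ℝ × K} (1 ∧ |β|) ν(dβ dω) < ∞` for each compact `K ⊆ Ω`. -/
def LocallyL1 {Ω : Type*} [TopologicalSpace Ω] [MeasurableSpace Ω]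
    (ν : Measure (ℝ × Ω)) : Prop :=
  ∀ K : Set Ω, IsCompact K →
    ∫⁻ z in Set.univ ×ˢ K, min 1 (ENNReal.ofReal |z.1|) ∂ν < ∞

/-- The indices `j < J` of the points of a point measure `m` with `J = m(E) ≤ ∞` points. -/
abbrev PointIndex {E : Type*} [MeasurableSpace E] (m : Measure E) : Type :=
  {j : ℕ // (j : ℝ≥0∞) < m Set.univ}

/-- `z` lists the points of `m`, with multiplicity: `m = ∑_{j < J} δ_{z_j}`, `J = m(E) ≤ ∞`. -/
def IsPointEnumeration {E : Type*} [MeasurableSpace E] (m : Measure E)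
    (z : PointIndex m → E) : Prop :=
  m = Measure.sum (fun j => Measure.dirac (z j))

/-- The uncompensated Poisson integral `𝓛[φ] = ∬ β φ(ω) N(dβ dω)`, as a function on the
sample space. -/
def levyField {S Ω : Type*} [MeasurableSpace Ω] (N : S → Measure (ℝ × Ω)) (φ : Ω → ℝ)
    (s : S) : ℝ :=
  ∫ z, z.1 * φ z.2 ∂(N s)

/-- The integrand `e^{i t φ(ω) β} - 1 - i t φ(ω) h(β)` of the Lévy exponent of `𝓛[φ]` with
compensator `h`. -/
def levyIntegrand {Ω : Type*} (h : ℝ → ℝ) (φ : Ω → ℝ) (t : ℝ) (z : ℝ × Ω) : ℂ :=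
  Complex.exp (Complex.I * t * φ z.2 * z.1) - 1 - Complex.I * t * φ z.2 * h z.1

end

end LevyField

/-! Everything is proved for a Poisson random measure `N` on a countably generated, countably
separated space and then applied to f(β, ω) = βφ(ω). Where |f| ≥ 1 the intensity is finite, so
almost surely `N` has finitely many points there (`IsNatValued.exists_eq_sum_dirac`); where |f| < 1,
Campbell's formula bounds the expected integral of |f|. Together these give absolute convergence
(`ae_integrable`). Cutting the space into countably many pieces of finite intensity lists the points
of `N`. For simple f the integral is a finite combination of independent Poisson variables, so its
characteristic function is a product of Poisson ones. Simple approximations bounded by 2|f| and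
dominated convergence on both sides give the general case (`integral_exp_integral`). -/

namespace LevyField

/-! ### Measures with natural-number values are finite sums of point masses. -/

section PointMeasures

variable {E : Type*} [MeasurableSpace E]

/-- A measure all of whose values are natural numbers. -/
def IsNatValued (m : Measure E) : Prop :=
  ∀ C : Set E, MeasurableSet C → ∃ n : ℕ, m C = n

lemma IsNatValued.isFiniteMeasure {m : Measure E} (hm : IsNatValued m) : IsFiniteMeasure m := by
  obtain ⟨n, hn⟩ := hm _ MeasurableSet.univ
  exact ⟨by simp [hn]⟩

lemma IsNatValued.one_le {m : Measure E} (hm : IsNatValued m) {C : Set E}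
    (hC : MeasurableSet C) (h : m C ≠ 0) : 1 ≤ m C := by
  obtain ⟨n, hn⟩ := hm C hC
  rw [hn] at h ⊢
  exact_mod_cast Nat.one_le_iff_ne_zero.2 (by exact_mod_cast h)

lemma IsNatValued.restrict {m : Measure E} (hm : IsNatValued m) {D : Set E}
    (hD : MeasurableSet D) : IsNatValued (m.restrict D) := fun C hC => by
  rw [Measure.restrict_apply hC]
  exact hm _ (hC.inter hD)

/-- Natural-number values on a generating π-system containing the whole space extend to all
measurable sets. -/
lemma isNatValued_of_piSystem (m : Measure E) {𝒜 : Set (Set E)}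
    (hgen : ‹MeasurableSpace E› = MeasurableSpace.generateFrom 𝒜) (hpi : IsPiSystem 𝒜)
    (huniv : ∃ n : ℕ, m Set.univ = n) (h : ∀ C ∈ 𝒜, ∃ n : ℕ, m C = n) : IsNatValued m := by
  obtain ⟨k, hk⟩ := huniv
  have : IsFiniteMeasure m := ⟨by simp [hk]⟩
  refine MeasurableSpace.induction_on_inter (C := fun C _ => ∃ n : ℕ, m C = n) hgen hpi
    ⟨0, by simp⟩ h ?_ ?_
  · rintro C hC ⟨n, hn⟩
    refine ⟨k - n, ?_⟩
    rw [measure_compl hC (measure_ne_top _ _), hk, hn, ENNReal.natCast_sub]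
  · intro f hd hf hn
    choose n hn using hn
    have hsum : ∑' i, (n i : ℝ≥0∞) = m (⋃ i, f i) := by
      rw [measure_iUnion hd hf]
      exact tsum_congr fun i => (hn i).symm
    -- A nonzero natural number is at least 1, so a series of them with finite sum has finitely many
    -- nonzero terms.
    have hfin : (Function.support n).Finite := by
      have := ENNReal.finite_const_le_of_tsum_ne_top
        (a := fun i => (n i : ℝ≥0∞)) (by rw [hsum]; exact measure_ne_top _ _) one_ne_zero
      refine this.subset fun i hi => ?_
      simpa [Nat.one_le_iff_ne_zero] using hi
    refine ⟨∑ i ∈ hfin.toFinset, n i, ?_⟩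
    rw [← hsum, tsum_eq_sum (s := hfin.toFinset)]
    · simp
    · intro i hi
      simpa using hi

/-- The total mass is the cardinality of `ι`, which is all that `PointIndex m` depends on. -/
lemma exists_pointEnumeration_of_countable {m : Measure E} {ι : Type*} [Countable ι]
    (z : ι → E) (hz : m = Measure.sum fun i => Measure.dirac (z i)) :
    ∃ w : PointIndex m → E, IsPointEnumeration m w := by
  suffices h : Nonempty (PointIndex m ≃ ι) by
    obtain ⟨e⟩ := h
    exact ⟨z ∘ e, hz.trans (Measure.sum_comp_equiv e fun i => Measure.dirac (z i)).symm⟩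
  rcases finite_or_infinite ι with h | h
  · have := Fintype.ofFinite ι
    have hm : m Set.univ = Fintype.card ι := by
      rw [hz, Measure.sum_apply _ MeasurableSet.univ]
      simp [tsum_fintype]
    have e : PointIndex m ≃ Fin (Fintype.card ι) :=
      (Equiv.subtypeEquivRight fun j => by rw [hm, Nat.cast_lt]).trans Fin.equivSubtype.symm
    exact ⟨e.trans (Fintype.equivFin ι).symm⟩
  · have hm : m Set.univ = ∞ := by
      rw [hz, Measure.sum_apply _ MeasurableSet.univ]
      simp
    have e : PointIndex m ≃ ℕ :=
      Equiv.subtypeUnivEquiv fun j => by rw [hm]; exact ENNReal.natCast_lt_top j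
    obtain ⟨d⟩ := nonempty_denumerable ι
    exact ⟨e.trans (Denumerable.eqv ι).symm⟩

variable [MeasurableSpace.CountablySeparated E]

/-- A nonzero measure with values in the natural numbers has an atom at a point. -/
lemma IsNatValued.exists_singleton_ne_zero {m : Measure E} (hm : IsNatValued m) (h0 : m ≠ 0) :
    ∃ x, m {x} ≠ 0 := by
  classical
  have := hm.isFiniteMeasure
  obtain ⟨A, hA, hsep⟩ := exists_seq_separating (α := E) MeasurableSet.univ Set.univ
  -- Bisection along a separating sequence, always keeping a half of nonzero mass. Integrality keeps
  -- that mass at least 1, so it survives in the limit, and no two points of the intersection are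
  -- separated.
  let B : ℕ → Set E := fun k => Nat.rec Set.univ
    (fun k B => if m (B ∩ A k) = 0 then B \ A k else B ∩ A k) k
  have hB (k : ℕ) : B (k + 1) = if m (B k ∩ A k) = 0 then B k \ A k else B k ∩ A k := rfl
  have hinv (k : ℕ) : MeasurableSet (B k) ∧ m (B k) ≠ 0 := by
    induction k with
    | zero => exact ⟨MeasurableSet.univ, by simpa [B] using h0⟩
    | succ k ih =>
      rw [hB]
      split_ifs with h
      · refine ⟨ih.1.diff (hA k), fun h' => ih.2 ?_⟩
        rw [← measure_inter_add_sdiff (B k) (hA k), h, h', add_zero]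
      · exact ⟨ih.1.inter (hA k), h⟩
  have hanti : Antitone B := antitone_nat_of_succ_le fun k => by
    rw [hB]
    split_ifs
    exacts [Set.sdiff_subset, Set.inter_subset_left]
  have hpos : 1 ≤ m (⋂ k, B k) := by
    rw [hanti.measure_iInter (fun k => (hinv k).1.nullMeasurableSet) ⟨0, measure_ne_top _ _⟩]
    exact le_iInf fun k => hm.one_le (hinv k).1 (hinv k).2
  obtain ⟨x, hx⟩ : (⋂ k, B k).Nonempty := by
    by_contra! h
    simp [h] at hpos
  have hsub : ⋂ k, B k ⊆ {x} := fun y hy => by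
    refine hsep y trivial x trivial fun k => ?_
    have hxk := Set.mem_iInter.1 hx (k + 1)
    have hyk := Set.mem_iInter.1 hy (k + 1)
    rw [hB] at hxk hyk
    split_ifs at hxk hyk
    · exact iff_of_false hyk.2 hxk.2
    · exact iff_of_true hyk.2 hxk.2
  exact ⟨x, (zero_lt_one.trans_le (hpos.trans (measure_mono hsub))).ne'⟩

/-- A measure with values in the natural numbers is a finite sum of unit point masses. -/
lemma IsNatValued.exists_eq_sum_dirac {m : Measure E} (hm : IsNatValued m) :
    ∃ (k : ℕ) (z : Fin k → E), m = Measure.sum fun i => Measure.dirac (z i) := by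
  -- Strong induction on the total mass: an atom may have multiplicity `a` > 1 and is removed all at
  -- once. Arbitrary finite index types let its `a` copies be adjoined as a disjoint sum.
  suffices h : ∀ (n : ℕ) (m : Measure E), IsNatValued m → m Set.univ = n →
      ∃ (ι : Type) (_ : Finite ι) (z : ι → E), m = Measure.sum fun i => Measure.dirac (z i) by
    obtain ⟨n, hn⟩ := hm _ MeasurableSet.univ
    obtain ⟨ι, _, z, hz⟩ := h n m hm hn
    obtain ⟨k, ⟨e⟩⟩ := Finite.exists_equiv_fin ι
    exact ⟨k, z ∘ e.symm, hz.trans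
      (Measure.sum_comp_equiv e.symm fun i => Measure.dirac (z i)).symm⟩
  have := MeasurableSpace.measurableSingletonClass_of_countablySeparated (α := E)
  intro n
  induction n using Nat.strong_induction_on with
  | _ n ih =>
    intro m hm hn
    by_cases h0 : m = 0
    · exact ⟨Empty, inferInstance, Empty.elim, by simp [h0]⟩
    obtain ⟨x, hx⟩ := hm.exists_singleton_ne_zero h0
    have := hm.isFiniteMeasure
    have hmx : MeasurableSet ({x} : Set E) := measurableSet_singleton x
    obtain ⟨a, ha⟩ := hm {x} hmx
    obtain ⟨b, hb⟩ := hm {x}ᶜ hmx.compl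
    have hab : a + b = n := by
      have := measure_add_measure_compl (μ := m) hmx
      rw [ha, hb, hn] at this
      exact_mod_cast this
    have ha0 : a ≠ 0 := by
      rintro rfl
      simp [ha] at hx
    obtain ⟨ι, _, z, hz⟩ := ih b (by omega) (m.restrict {x}ᶜ) (hm.restrict hmx.compl)
      (by rw [Measure.restrict_apply_univ, hb])
    have := Fintype.ofFinite ι
    refine ⟨Fin a ⊕ ι, inferInstance, Sum.elim (fun _ => x) z, ?_⟩
    rw [← Measure.restrict_add_restrict_compl (μ := m) hmx, hz, Measure.restrict_singleton, ha]
    ext s hs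
    simp [Fintype.sum_sum_type]

end PointMeasures

/-- The Bochner integral is 0 off the measurable set of measures integrating `f`, and on it a
difference of two lower integrals, each measurable in the measure. -/
lemma measurable_integral_measure {E : Type*} [MeasurableSpace E] {f : E → ℝ}
    (hf : Measurable f) : Measurable fun m : Measure E => ∫ x, f x ∂m := by
  classical
  have h : (fun m : Measure E => ∫ x, f x ∂m) = fun m =>
      if ∫⁻ x, ‖f x‖ₑ ∂m < ∞ then (∫⁻ x, ENNReal.ofReal (f x) ∂m).toReal -
        (∫⁻ x, ENNReal.ofReal (-f x) ∂m).toReal else 0 := by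
    funext m
    split_ifs with h
    · exact integral_eq_lintegral_pos_part_sub_lintegral_neg_part ⟨hf.aestronglyMeasurable, h⟩
    · exact integral_undef fun h' => h h'.2
  rw [h]
  refine Measurable.ite ?_ ?_ measurable_const
  · exact measurableSet_lt (Measure.measurable_lintegral hf.enorm) measurable_const
  · exact (Measure.measurable_lintegral hf.ennreal_ofReal).ennreal_toReal.sub
      (Measure.measurable_lintegral hf.neg.ennreal_ofReal).ennreal_toReal

/-! ### Mean, support and characteristic function of the Poisson law. -/

section PoissonLaw

lemma lintegral_natCast_poissonMeasure (r : NNReal) :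
    ∫⁻ n : ℕ, (n : ℝ≥0∞) ∂poissonMeasure r = r := by
  have h1 : ∑' n : ℕ, ENNReal.ofReal (Real.exp (-r) * r ^ n / n.factorial) = 1 := by
    rw [← ENNReal.ofReal_tsum_of_nonneg (fun n => by positivity)
      (hasSum_one_poissonMeasure r).summable, (hasSum_one_poissonMeasure r).tsum_eq,
      ENNReal.ofReal_one]
  have hs (n : ℕ) : ENNReal.ofReal (Real.exp (-r) * r ^ (n + 1) / (n + 1).factorial) *
      ((n + 1 : ℕ) : ℝ≥0∞) = r * ENNReal.ofReal (Real.exp (-r) * r ^ n / n.factorial) := by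
    rw [← ENNReal.ofReal_natCast, ← ENNReal.ofReal_coe_nnreal,
      ← ENNReal.ofReal_mul (by positivity), ← ENNReal.ofReal_mul (by positivity),
      Nat.factorial_succ]
    congr 1
    push_cast
    field_simp
    ring
  rw [poissonMeasure, lintegral_sum_measure]
  simp only [lintegral_smul_measure, lintegral_dirac, smul_eq_mul]
  -- The term n = 0 vanishes, and by `hs` the shifted series is `r` times the total mass.
  rw [tsum_eq_zero_add' ENNReal.summable]
  simp only [hs, ENNReal.tsum_mul_left, h1]
  simp

lemma lintegral_poissonLaw (m : ℝ≥0∞) : ∫⁻ x, x ∂poissonLaw m = m := by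
  unfold poissonLaw
  split_ifs with h
  · simp [h]
  · rw [lintegral_map (f := fun x => x) measurable_id .of_discrete, lintegral_natCast_poissonMeasure,
      ENNReal.coe_toNNReal h]

lemma ae_poissonLaw_exists_natCast {m : ℝ≥0∞} (hm : m ≠ ∞) :
    ∀ᵐ x ∂poissonLaw m, ∃ n : ℕ, x = (n : ℝ≥0∞) := by
  have hmeas : MeasurableSet {x : ℝ≥0∞ | ∃ n : ℕ, x = (n : ℝ≥0∞)} := by
    have : {x : ℝ≥0∞ | ∃ n : ℕ, x = (n : ℝ≥0∞)} = Set.range fun n : ℕ => (n : ℝ≥0∞) := by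
      ext x
      simp [eq_comm]
    rw [this]
    exact (Set.countable_range _).measurableSet
  rw [poissonLaw, if_neg hm, ae_map_iff Measurable.of_discrete.aemeasurable hmeas]
  exact .of_forall fun n => ⟨n, rfl⟩

lemma integral_exp_poissonLaw {m : ℝ≥0∞} (hm : m ≠ ∞) (θ : ℝ) :
    ∫ x, Complex.exp (Complex.I * (θ * x.toReal : ℝ)) ∂poissonLaw m =
      Complex.exp (m.toReal * (Complex.exp (Complex.I * θ) - 1)) := by
  have h := charFun_map_cast_poissonMeasure m.toNNReal θ
  rw [charFun_apply, integral_map .of_discrete (by fun_prop)] at h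
  unfold poissonLaw
  rw [if_neg hm, integral_map Measurable.of_discrete.aemeasurable
    (Measurable.aestronglyMeasurable (by fun_prop))]
  convert! h using 1
  · refine integral_congr_ae (.of_forall fun n => ?_)
    simp [mul_comm]
  · rw [mul_comm Complex.I]; rfl

end PoissonLaw

/-! ### Poisson random measures: points, Campbell's formula, simple integrands. -/

namespace IsPoissonRandomMeasure

open Filter Topology

variable {S E : Type*} [MeasurableSpace S] [MeasurableSpace E] {N : S → Measure E}
  {ν : Measure E} {P : Measure S}

lemma measurable_apply (hN : IsPoissonRandomMeasure N ν P) {C : Set E} (hC : MeasurableSet C) :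
    Measurable fun s => N s C :=
  (Measure.measurable_coe hC).comp hN.measurable

lemma ae_exists_natCast (hN : IsPoissonRandomMeasure N ν P) {C : Set E}
    (hC : MeasurableSet C) (hfin : ν C ≠ ∞) : ∀ᵐ s ∂P, ∃ n : ℕ, N s C = n := by
  have h := ae_poissonLaw_exists_natCast hfin
  rw [← hN.map_eq C hC] at h
  exact ae_of_ae_map (hN.measurable_apply hC).aemeasurable h

/-- The exceptional null set depends on the set being measured. A countable generating algebra
allows a single null set, and `isNatValued_of_piSystem` extends integrality to all measurable sets.
-/
lemma ae_isNatValued_restrict [MeasurableSpace.CountablyGenerated E]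
    (hN : IsPoissonRandomMeasure N ν P) {D : Set E} (hD : MeasurableSet D) (hfin : ν D ≠ ∞) :
    ∀ᵐ s ∂P, IsNatValued ((N s).restrict D) := by
  set 𝒜 := generateSetAlgebra (MeasurableSpace.countableGeneratingSet E) with h𝒜
  have hcount : 𝒜.Countable :=
    countable_generateSetAlgebra MeasurableSpace.countable_countableGeneratingSet
  have hgen : ‹MeasurableSpace E› = MeasurableSpace.generateFrom 𝒜 := by
    rw [h𝒜, generateFrom_generateSetAlgebra_eq,
      MeasurableSpace.generateFrom_countableGeneratingSet]
  have hmeas : ∀ C ∈ 𝒜, MeasurableSet C := fun C hC => by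
    rw [hgen]
    exact MeasurableSpace.measurableSet_generateFrom hC
  have halg : IsSetAlgebra 𝒜 := isSetAlgebra_generateSetAlgebra
  have hall : ∀ᵐ s ∂P, ∀ C ∈ 𝒜, ∃ n : ℕ, N s (C ∩ D) = n :=
    (ae_ball_iff hcount).2 fun C hC => hN.ae_exists_natCast ((hmeas C hC).inter hD)
      (measure_ne_top_of_subset Set.inter_subset_right hfin)
  filter_upwards [hall] with s hs
  have hs' : ∀ C ∈ 𝒜, ∃ n : ℕ, (N s).restrict D C = n := fun C hC => by
    rw [Measure.restrict_apply (hmeas C hC)]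
    exact hs C hC
  exact isNatValued_of_piSystem _ hgen (fun A hA B hB _ => halg.inter_mem hA hB)
    (hs' _ halg.univ_mem) hs'

lemma bind_eq (hN : IsPoissonRandomMeasure N ν P) : P.bind N = ν := by
  ext C hC
  rw [Measure.bind_apply hC hN.measurable.aemeasurable, ← lintegral_poissonLaw (ν C),
    ← hN.map_eq C hC, lintegral_map (f := fun x => x) measurable_id (hN.measurable_apply hC)]

/-- Campbell's formula. -/
lemma lintegral_lintegral (hN : IsPoissonRandomMeasure N ν P) {f : E → ℝ≥0∞}
    (hf : Measurable f) : ∫⁻ s, ∫⁻ z, f z ∂N s ∂P = ∫⁻ z, f z ∂ν := by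
  rw [← Measure.lintegral_bind hN.measurable.aemeasurable hf.aemeasurable, hN.bind_eq]

lemma ae_lintegral_lt_top (hN : IsPoissonRandomMeasure N ν P) {f : E → ℝ≥0∞}
    (hf : Measurable f) (hfin : ∫⁻ z, f z ∂ν ≠ ∞) : ∀ᵐ s ∂P, ∫⁻ z, f z ∂N s < ∞ :=
  ae_lt_top ((Measure.measurable_lintegral hf).comp hN.measurable)
    (by rwa [← hN.lintegral_lintegral hf] at hfin)

lemma ae_integrable_of_integrable (hN : IsPoissonRandomMeasure N ν P) {f : E → ℝ}
    (hf : Measurable f) (hfi : Integrable f ν) : ∀ᵐ s ∂P, Integrable f (N s) := by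
  filter_upwards [hN.ae_lintegral_lt_top hf.enorm hfi.2.ne] with s hs
  exact ⟨hf.aestronglyMeasurable, hs⟩

/-- Truncated integrability against the intensity gives almost sure integrability. -/
lemma ae_integrable [MeasurableSpace.CountablyGenerated E] [MeasurableSpace.CountablySeparated E]
    (hN : IsPoissonRandomMeasure N ν P) {f : E → ℝ} (hf : Measurable f)
    (hfi : Integrable (fun z => min 1 |f z|) ν) : ∀ᵐ s ∂P, Integrable f (N s) := by
  -- On `A` there are finitely many points; off `A` the truncation is inactive, so `f` itself is
  -- integrable against `ν`.
  have hA : MeasurableSet {z | 1 ≤ |f z|} := measurableSet_le measurable_const (by fun_prop)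
  set A := {z | 1 ≤ |f z|}
  have hAfin : ν A ≠ ∞ := by
    refine ((measure_mono ?_).trans_lt (hfi.measure_ge_lt_top one_pos)).ne
    exact fun z (hz : 1 ≤ |f z|) => le_min le_rfl hz
  have hsmall : Integrable (Aᶜ.indicator f) ν := by
    refine hfi.mono' (hf.indicator hA.compl).aestronglyMeasurable (.of_forall fun z => ?_)
    by_cases hz : z ∈ A
    · simp [hz]
    · have : |f z| ≤ 1 := (not_le.1 hz).le
      simp [Set.indicator, hz, this]
  filter_upwards [hN.ae_integrable_of_integrable (hf.indicator hA.compl) hsmall,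
    hN.ae_isNatValued_restrict hA hAfin] with s h1 h2
  rw [← integrableOn_univ, ← Set.union_compl_self A, integrableOn_union]
  refine ⟨?_, (integrable_indicator_iff hA.compl).1 h1⟩
  obtain ⟨k, z, hz⟩ := h2.exists_eq_sum_dirac
  have := MeasurableSpace.measurableSingletonClass_of_countablySeparated (α := E)
  rw [IntegrableOn, hz, Measure.sum_fintype, integrable_finsetSum_measure]
  exact fun i _ => integrable_dirac (by simp)

lemma ae_exists_pointEnumeration [MeasurableSpace.CountablyGenerated E]
    [MeasurableSpace.CountablySeparated E] [SigmaFinite ν] (hN : IsPoissonRandomMeasure N ν P) :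
    ∀ᵐ s ∂P, ∃ z : PointIndex (N s) → E, IsPointEnumeration (N s) z := by
  set D := disjointed (spanningSets ν)
  have hD (n : ℕ) : MeasurableSet (D n) := .disjointed (measurableSet_spanningSets ν) n
  have hfin (n : ℕ) : ν (D n) ≠ ∞ :=
    measure_ne_top_of_subset (disjointed_subset _ _) (measure_spanningSets_lt_top ν n).ne
  filter_upwards [ae_all_iff.2 fun n => hN.ae_isNatValued_restrict (hD n) (hfin n)] with s hs
  choose k z hz using fun n => (hs n).exists_eq_sum_dirac
  refine exists_pointEnumeration_of_countable (fun i : Σ n, Fin (k n) => z i.1 i.2) ?_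
  ext C hC
  rw [← sum_restrict_disjointed_spanningSets (N s) ν, Measure.sum_apply _ hC,
    Measure.sum_apply _ hC, ENNReal.tsum_sigma']
  refine tsum_congr fun n => ?_
  rw [← Measure.sum_apply _ hC, ← hz n]

lemma measurable_integral (hN : IsPoissonRandomMeasure N ν P) {f : E → ℝ}
    (hf : Measurable f) : Measurable fun s => ∫ z, f z ∂N s :=
  (measurable_integral_measure hf).comp hN.measurable

lemma integral_exp_apply (hN : IsPoissonRandomMeasure N ν P) {C : Set E} (hC : MeasurableSet C)
    (hfin : ν C ≠ ∞) (θ : ℝ) :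
    ∫ s, Complex.exp (Complex.I * (θ * (N s).real C : ℝ)) ∂P =
      Complex.exp (ν.real C * (Complex.exp (Complex.I * θ) - 1)) := by
  rw [measureReal_def, ← integral_exp_poissonLaw hfin, ← hN.map_eq C hC,
    integral_map (hN.measurable_apply hC).aemeasurable
      (Measurable.aestronglyMeasurable (by fun_prop))]
  rfl

lemma integral_exp_simpleFunc (hN : IsPoissonRandomMeasure N ν P) (g : SimpleFunc E ℝ)
    (hg : Integrable g ν) :
    ∫ s, Complex.exp (Complex.I * (∫ z, g z ∂N s : ℝ)) ∂P =
      Complex.exp (∫ z, (Complex.exp (Complex.I * g z) - 1) ∂ν) := by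
  classical
  -- The value 0 is dropped because its fibre may have infinite intensity; the other fibres are
  -- disjoint, of finite intensity, and carry independent Poisson counts.
  set F := g.range.filter (· ≠ 0) with hF
  let e := F.equivFin.symm
  let C : Fin F.card → Set E := fun i => g ⁻¹' {(e i : ℝ)}
  have he (i) : (e i : ℝ) ≠ 0 := (Finset.mem_filter.1 (e i).2).2
  have hC (i) : MeasurableSet (C i) := g.measurableSet_fiber _
  have hCfin (i) : ν (C i) ≠ ∞ := (SimpleFunc.integrable_iff.1 hg _ (he i)).ne
  have hdisj (i j) (hij : i ≠ j) : Disjoint (C i) (C j) := by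
    refine Disjoint.preimage _ (Set.disjoint_singleton.2 fun h => hij ?_)
    exact e.injective (Subtype.ext h)
  have hsum {M : Type} [AddCommMonoid M] (u : ℝ → M) : ∑ c ∈ F, u c = ∑ i, u (e i) := by
    rw [← Finset.sum_coe_sort F, ← Equiv.sum_comp e]
  have hleft : ∫ s, Complex.exp (Complex.I * (∫ z, g z ∂N s : ℝ)) ∂P =
      ∫ s, ∏ i, Complex.exp (Complex.I * ((e i : ℝ) * (N s (C i)).toReal : ℝ)) ∂P := by
    refine integral_congr_ae ?_
    filter_upwards [hN.ae_integrable_of_integrable g.measurable hg] with s hs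
    rw [← g.integral_eq_integral hs, g.integral_eq_sum_filter, ← hF, hsum, ← Complex.exp_sum,
      ← Finset.mul_sum]
    push_cast
    simp [C, Measure.real, mul_comm]
  have hright : ∫ z, (Complex.exp (Complex.I * g z) - 1) ∂ν =
      ∑ i, ν.real (C i) * (Complex.exp (Complex.I * (e i : ℝ)) - 1) := by
    let u : ℝ → ℂ := fun x => Complex.exp (Complex.I * x) - 1
    have hu : u 0 = 0 := by simp [u]
    have hmap : Integrable (g.map u) ν := by
      refine SimpleFunc.integrable_iff_finMeasSupp.2 ?_
      exact (SimpleFunc.integrable_iff_finMeasSupp.1 hg).map hu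
    calc ∫ z, (Complex.exp (Complex.I * g z) - 1) ∂ν = ∫ z, g.map u z ∂ν := rfl
      _ = ∑ c ∈ g.range, ν.real (g ⁻¹' {c}) • u c := by
        rw [← SimpleFunc.integral_eq_integral _ hmap, SimpleFunc.map_integral _ _ hg hu]
      _ = ∑ c ∈ F, ν.real (g ⁻¹' {c}) • u c := by
        refine (Finset.sum_filter_of_ne fun c _ hc => ?_).symm
        rintro rfl
        simp [hu] at hc
      _ = _ := by
        rw [hsum]
        simp [u, C]
  rw [hleft, hright, Complex.exp_sum,
    (hN.indep _ C hC hdisj).integral_fun_prod_comp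
      (f := fun i x => Complex.exp (Complex.I * ((e i : ℝ) * x.toReal : ℝ)))
      (fun i => (hN.measurable_apply (hC i)).aemeasurable)
      (fun i => Measurable.aestronglyMeasurable (by fun_prop))]
  exact Finset.prod_congr rfl fun i _ => hN.integral_exp_apply (hC i) (hCfin i) _

end IsPoissonRandomMeasure

/-! ### Integrability of the exponent and the general characteristic function. -/

lemma norm_exp_I_mul_sub_one_le (x : ℝ) :
    ‖Complex.exp (Complex.I * x) - 1‖ ≤ 2 * min 1 |x| := by
  have h1 : ‖Complex.exp (Complex.I * x) - 1‖ ≤ |x| :=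
    Real.norm_exp_I_mul_ofReal_sub_one_le
  have h2 : ‖Complex.exp (Complex.I * x) - 1‖ ≤ 2 := by
    refine (norm_sub_le _ _).trans ?_
    rw [Complex.norm_exp_I_mul_ofReal]
    norm_num
  rcases le_total 1 |x| with h | h
  · rw [min_eq_left h]; linarith
  · rw [min_eq_right h]; linarith [abs_nonneg x]

lemma integrable_exp_I_mul_sub_one {E : Type*} [MeasurableSpace E] {ν : Measure E} {f : E → ℝ}
    (hf : Measurable f) (hfi : Integrable (fun z => min 1 |f z|) ν) :
    Integrable (fun z => Complex.exp (Complex.I * f z) - 1) ν :=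
  (hfi.const_mul 2).mono' (Measurable.aestronglyMeasurable (by fun_prop))
    (.of_forall fun z => norm_exp_I_mul_sub_one_le (f z))

/-- Lets `t` be absorbed into the integrand, so that characteristic functions need only be computed
at argument 1. -/
lemma integrable_min_one_abs_const_mul {E : Type*} [MeasurableSpace E] {ν : Measure E} {f : E → ℝ}
    (hf : Measurable f) (hfi : Integrable (fun z => min 1 |f z|) ν) (t : ℝ) :
    Integrable (fun z => min 1 |t * f z|) ν := by
  refine (hfi.const_mul (1 + |t|)).mono' (Measurable.aestronglyMeasurable (by fun_prop))
    (.of_forall fun z => ?_)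
  have ht := abs_nonneg t
  have hz := abs_nonneg (f z)
  rw [Real.norm_of_nonneg (by positivity), abs_mul]
  rcases le_total 1 |f z| with h | h
  · rw [min_eq_left h]
    exact (min_le_left _ _).trans (by linarith)
  · rw [min_eq_right h]
    exact (min_le_right _ _).trans (by nlinarith)

lemma integrable_min_one_abs_of_lintegral {E : Type*} [MeasurableSpace E] {ν : Measure E}
    {f : E → ℝ} (hf : Measurable f) (hint : ∫⁻ z, min 1 (ENNReal.ofReal |f z|) ∂ν < ∞) :
    Integrable (fun z => min 1 |f z|) ν := by
  refine ⟨Measurable.aestronglyMeasurable (by fun_prop), ?_⟩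
  refine (lintegral_congr fun z => ?_).trans_lt hint
  rw [Real.enorm_of_nonneg (by positivity), ENNReal.ofReal_min, ENNReal.ofReal_one]

open Filter Topology in
/-- The characteristic function of a Poisson integral. -/
lemma IsPoissonRandomMeasure.integral_exp_integral {S E : Type*} [MeasurableSpace S]
    [MeasurableSpace E] [MeasurableSpace.CountablyGenerated E]
    [MeasurableSpace.CountablySeparated E] {N : S → Measure E} {ν : Measure E} {P : Measure S}
    [IsProbabilityMeasure P] (hN : IsPoissonRandomMeasure N ν P) {f : E → ℝ} (hf : Measurable f)
    (hfi : Integrable (fun z => min 1 |f z|) ν) :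
    ∫ s, Complex.exp (Complex.I * (∫ z, f z ∂N s : ℝ)) ∂P =
      Complex.exp (∫ z, (Complex.exp (Complex.I * f z) - 1) ∂ν) := by
  let g : ℕ → SimpleFunc E ℝ := SimpleFunc.approxOn f hf Set.univ 0 trivial
  have hlim (z : E) : Tendsto (fun n => g n z) atTop (𝓝 (f z)) :=
    SimpleFunc.tendsto_approxOn hf (Set.mem_univ 0) (by simp)
  have hle (n : ℕ) (z : E) : |g n z| ≤ 2 * |f z| := by
    simpa [two_mul] using SimpleFunc.norm_approxOn_zero_le hf (s := Set.univ) trivial z n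
  -- Although `f` need not be integrable, a nonzero value y of `g n` forces |f| ≥ |y|/2, a set of
  -- finite intensity.
  have hgi (n : ℕ) : Integrable (g n) ν := by
    refine SimpleFunc.integrable_iff.2 fun y hy => ?_
    have hpos : 0 < min 1 (|y| / 2) := by positivity
    refine (measure_mono (t := {z | min 1 (|y| / 2) ≤ min 1 |f z|}) fun z hz => ?_).trans_lt
      (hfi.measure_ge_lt_top hpos)
    have := hle n z
    rw [show g n z = y from hz] at this
    have hyf : |y| / 2 ≤ |f z| := by linarith
    exact min_le_min le_rfl hyf
  have h1 : Tendsto (fun n => ∫ s, Complex.exp (Complex.I * (∫ z, g n z ∂N s : ℝ)) ∂P) atTop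
      (𝓝 (∫ s, Complex.exp (Complex.I * (∫ z, f z ∂N s : ℝ)) ∂P)) := by
    refine tendsto_integral_of_dominated_convergence (fun _ => 1) (fun n => ?_)
      (integrable_const _) (fun n => .of_forall fun s => ?_) ?_
    · have := hN.measurable_integral (g n).measurable
      exact Measurable.aestronglyMeasurable (by fun_prop)
    · rw [Complex.norm_exp_I_mul_ofReal]
    · filter_upwards [hN.ae_integrable hf hfi] with s hs
      have hint : Tendsto (fun n => ∫ z, g n z ∂N s) atTop (𝓝 (∫ z, f z ∂N s)) :=
        tendsto_integral_of_dominated_convergence (fun z => 2 * |f z|)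
          (fun n => (g n).measurable.aestronglyMeasurable) (hs.abs.const_mul 2)
          (fun n => .of_forall (hle n)) (.of_forall hlim)
      have hcont : Continuous fun x : ℝ => Complex.exp (Complex.I * x) := by fun_prop
      exact (hcont.tendsto _).comp hint
  have h2 : Tendsto (fun n => ∫ z, (Complex.exp (Complex.I * g n z) - 1) ∂ν) atTop
      (𝓝 (∫ z, (Complex.exp (Complex.I * f z) - 1) ∂ν)) := by
    -- 4 = 2 · 2: one factor from `norm_exp_I_mul_sub_one_le`, one from |g n| ≤ 2|f|.
    refine tendsto_integral_of_dominated_convergence (fun z => 4 * min 1 |f z|) (fun n => ?_)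
      (hfi.const_mul 4) (fun n => .of_forall fun z => ?_) (.of_forall fun z => ?_)
    · have := (g n).measurable
      exact Measurable.aestronglyMeasurable (by fun_prop)
    · refine (norm_exp_I_mul_sub_one_le _).trans ?_
      have : min 1 |g n z| ≤ 2 * min 1 |f z| := by
        rw [mul_min_of_nonneg _ _ zero_le_two]
        exact min_le_min (by norm_num) (hle n z)
      linarith
    · have hcont : Continuous fun x : ℝ => Complex.exp (Complex.I * x) - 1 := by fun_prop
      exact (hcont.tendsto _).comp (hlim z)
  refine tendsto_nhds_unique h1 ?_
  simp_rw [fun n => hN.integral_exp_simpleFunc (g n) (hgi n)]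
  exact (Complex.continuous_exp.tendsto _).comp h2

end LevyField

/-! ### The theorem for the integrand βφ(ω). -/

theorem proposition1
    {Ω : Type*} [MetricSpace Ω] [CompleteSpace Ω] [TopologicalSpace.SeparableSpace Ω]
    [MeasurableSpace Ω] [BorelSpace Ω]
    (ν : Measure (ℝ × Ω)) (hν : LevyField.IsLevyMeasure ν) (hν1 : LevyField.LocallyL1 ν)
    {S : Type*} [MeasurableSpace S] (P : Measure S) [IsProbabilityMeasure P]
    (N : S → Measure (ℝ × Ω)) (hN : LevyField.IsPoissonRandomMeasure N ν P)
    (φ : Ω → ℝ) (hφ : Measurable φ)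
    (hint : ∫⁻ z, min 1 (ENNReal.ofReal |z.1 * φ z.2|) ∂ν < ∞) :
    -- almost surely the integral converges absolutely, `N` is a sum of `J = N(ℝ × Ω) ≤ ∞` unit
    -- point masses, and the sum over the points, however listed, converges to the integral
    (∀ᵐ s ∂P,
      Integrable (fun z : ℝ × Ω => z.1 * φ z.2) (N s) ∧
      (∃ z : LevyField.PointIndex (N s) → ℝ × Ω, LevyField.IsPointEnumeration (N s) z) ∧
      ∀ z : LevyField.PointIndex (N s) → ℝ × Ω, LevyField.IsPointEnumeration (N s) z →
        HasSum (fun j => φ (z j).2 * (z j).1) (LevyField.levyField N φ s)) ∧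
    -- the integral is a random variable
    Measurable (LevyField.levyField N φ) ∧
    -- its characteristic function, with compensator `h ≡ 0`
    ∀ t : ℝ,
      Integrable (LevyField.levyIntegrand (fun _ => 0) φ t) ν ∧
      ∫ s, Complex.exp (Complex.I * t * LevyField.levyField N φ s) ∂P =
        Complex.exp (∫ z, LevyField.levyIntegrand (fun _ => 0) φ t z ∂ν) := by
  have hf : Measurable fun z : ℝ × Ω => z.1 * φ z.2 := by fun_prop
  have hfi := LevyField.integrable_min_one_abs_of_lintegral hf hint
  -- Second countability makes the σ-algebra of ℝ × Ω countably generated and countably separated.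
  have : SecondCountableTopology Ω := UniformSpace.secondCountable_of_separable Ω
  have := hν.sigmaFinite
  refine ⟨?_, hN.measurable_integral hf, fun t => ?_⟩
  · filter_upwards [hN.ae_integrable hf hfi, hN.ae_exists_pointEnumeration] with s h1 h2
    refine ⟨h1, h2, fun z hz => ?_⟩
    have hz' : N s = Measure.sum fun j => Measure.dirac (z j) := hz
    -- Integrability against a sum of point masses is absolute summability over the points, hence
    -- unconditional convergence for any listing.
    have h := hasSum_integral_measure (hz' ▸ h1)
    simp only [integral_dirac] at h
    rw [← hz'] at h
    simpa only [LevyField.levyField, mul_comm] using h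
  · have hti := LevyField.integrable_min_one_abs_const_mul hf hfi t
    have heq : LevyField.levyIntegrand (fun _ => 0) φ t = fun z : ℝ × Ω =>
        Complex.exp (Complex.I * (t * (z.1 * φ z.2) : ℝ)) - 1 := by
      funext z
      simp only [LevyField.levyIntegrand, Complex.ofReal_zero, mul_zero, sub_zero]
      push_cast
      ring_nf
    rw [heq]
    refine ⟨LevyField.integrable_exp_I_mul_sub_one (hf.const_mul t) hti, ?_⟩
    rw [← hN.integral_exp_integral (hf.const_mul t) hti]
    refine integral_congr_ae (.of_forall fun s => ?_)
    simp only [LevyField.levyField, integral_const_mul, Complex.ofReal_mul, mul_assoc]
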